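/- Proposition (reliability). Let $k\ge 1$ and $n\ge k+1$ be integers and let $0<q<1$. Consider the two-dimensional consecutive $k$-out-of-$n$:$F$ system ($n\times n$ components, each failed with probability $q$ independently of the others, the system failing if some $k\times k$ subgrid has all its components failed). Put $\psi=q^{k^2}$ and let $U$ be the compound Poisson random variable used to approximate the number of completely failed $k\times k$ subgrids, defined by $$\lambda_j=\frac{\psi}{j}\left[4\pi_1(j)+4(n-k-1)\pi_2(j)+(n-k-1)^2\pi_3(j)\right],\qquad \pi_i(j)=\mathbb P(\mathrm{Bin}(i+1,q^k)=j-1),$$ for $j=1,\dots,5$, and $\lambda_j=0$ for $j\ge 6$. That is, $U$ is distributed as $\sum_{i=1}^N X_i$, where $N$ is Poisson with mean $\lambda=\sum_j\lambda_j$ and the $X_i$ are i.i.d., independent of $N$, with $\mathbb P(X_i=j)=\lambda_j/\lambda$. For $y\in\mathbb Z^+=\{0,1,2,\dots\}$ and $h=I(\cdot\le y)$, let $f_h$ be the bounded solution, with the convention $f_h(0)=0$, of the Stein equation $$h(x)-\mathbb E h(U)=\sum_{j\ge 1} j\lambda_j f_h(x+j)-x f_h(x),\qquad x\in\mathbb Z^+,$$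 and let $$M_1^{(K)}=\sup_{y\in\mathbb Z^+}\ \sup_{x\in\mathbb Z^+}|f_h(x+1)-f_h(x)| .$$ If $q^k<1/4$, then $f_h$ exists and is unique for every such $h$, $\delta>0$, and $$M_1^{(K)}\le\frac{1}{2\delta}\left[1+\log^+(\pi\delta)\right],$$ where $\log^+$ is the positive part of the natural logarithm and $$\delta=\psi\left[4(1-2q^k)^2+4(n-k-1)(1-2q^k)^3+(n-k-1)^2(1-4q^k)(1-4q^k+8q^{2k})\right].$$ -/

import Mathlib

open MeasureTheory ProbabilityTheory
open scoped ENNReal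

noncomputable section

/-- The total rate `λ = ∑_{j ≥ 1} λ_j` of a compound Poisson distribution with clump rates
`λ_j = lam j` (with `lam 0 = 0`). -/
def totalRate (lam : ℕ → ℝ) : ℝ := ∑' j, lam j

/-- The clump-size distribution `P(X = j) = μ_j = λ_j / λ`. -/
def clumpLaw (lam : ℕ → ℝ) : Measure ℕ :=
  Measure.sum fun j => ENNReal.ofReal (lam j / totalRate lam) • Measure.dirac j

/-- The compound Poisson distribution `CP(λ, μ)`, parametrized by the rates `λ_j = λ μ_j`:
the law of `X_1 + ⋯ + X_N`, where `N` is Poisson with mean `λ` and the `X_i` are i.i.d. with law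
`clumpLaw lam`, independent of `N`. -/
def compoundPoisson (lam : ℕ → ℝ) : Measure ℕ :=
  (poissonMeasure (totalRate lam).toNNReal).bind fun N =>
    (Measure.pi fun _ : Fin N => clumpLaw lam).map fun x => ∑ i, x i

/-- `f` is the bounded solution of the Stein equation
`h(x) - E h(U) = ∑_{j ≥ 1} j λ_j f(x + j) - x f(x)`, `x = 0, 1, 2, …`, for the compound Poisson
distribution of `U` with rates `λ_j`. The equation does not involve `f 0`, which is set to `0`. -/
structure IsSteinSolution (lam : ℕ → ℝ) (h f : ℕ → ℝ) : Prop where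
  bounded : ∃ C : ℝ, ∀ x, |f x| ≤ C
  zero : f 0 = 0
  equation : ∀ x : ℕ, h x - ∫ u, h u ∂(compoundPoisson lam) =
    (∑' j : ℕ, (j : ℝ) * lam j * f (x + j)) - (x : ℝ) * f x

/-- The test function `x ↦ I(x ≤ y)` of the Kolmogorov distance. -/
def kolmogorovTest (y : ℕ) : ℕ → ℝ := Set.indicator (Set.Iic y) 1

/-- The Stein factor `M_1^{(K)} = sup_{h} sup_{x} |f_h(x + 1) - f_h(x)|`, the suprema being over
the test functions `h = I(· ≤ y)`, `y = 0, 1, 2, …`, and over `x = 0, 1, 2, …`. -/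
def steinM1K (lam : ℕ → ℝ) : ℝ≥0∞ :=
  ⨆ (y : ℕ) (f : ℕ → ℝ) (_ : IsSteinSolution lam (kolmogorovTest y) f) (x : ℕ),
    ENNReal.ofReal |f (x + 1) - f x|

/-- The binomial point probabilities `π_i(j) = P(Bin(i + 1, q^k) = j - 1)`, for `j ≥ 1`. -/
def reliabilityPi (k : ℕ) (q : unitInterval) (i j : ℕ) : ℝ :=
  (binomial (i + 1) (q ^ k)).real {j - 1}

/-- The rates `λ_j` of the compound Poisson approximation for the two-dimensional consecutive
`k`-out-of-`n`:`F` system with component failure probability `q`; here `ψ = q^{k²}`. -/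
def reliabilityRate (n k : ℕ) (q : unitInterval) (j : ℕ) : ℝ :=
  if 1 ≤ j ∧ j ≤ 5 then
    1 / (j : ℝ) * (q : ℝ) ^ k ^ 2 *
      (4 * reliabilityPi k q 1 j + 4 * ((n : ℝ) - k - 1) * reliabilityPi k q 2 j
        + ((n : ℝ) - k - 1) ^ 2 * reliabilityPi k q 3 j)
  else 0

/-- `δ = ψ [4 a(q^k) + 4 (n - k - 1) b(q^k) + (n - k - 1)² c(q^k)]`, where `ψ = q^{k²}`,
`a(y) = (1 - 2y)²`, `b(y) = (1 - 2y)³` and `c(y) = (1 - 4y)(1 - 4y + 8y²)`. -/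
def reliabilityDelta (n k : ℕ) (q : ℝ) : ℝ :=
  q ^ k ^ 2 * (4 * (1 - 2 * q ^ k) ^ 2 + 4 * ((n : ℝ) - k - 1) * (1 - 2 * q ^ k) ^ 3
    + ((n : ℝ) - k - 1) ^ 2 * ((1 - 4 * q ^ k) * (1 - 4 * q ^ k + 8 * q ^ (2 * k))))

end

/-! Write `L` for `logPgf`, so that `exp (L z)` is the generating function of the compound Poisson
law. Taking generating functions in `y` merges the Stein equations for all `I(· ≤ y)` into one,
solved by `∫₀¹ w ^ (x - 1) * exp (L z - L w) ds` along the segment `w = 1 + s (z - 1)`; the solution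
at `x` is the `y`-th Fourier coefficient of this on the unit circle. The Stein operator makes the
integrand a total derivative (`sub_one_mul_steinOperatorTransform`).

Raising `x` by one multiplies the integrand by `s (z - 1)`. Under `IsDissipative` the exponential
has modulus at most `exp (-δ (1 - s) (1 - cos θ))`, so the circle average of `|z - 1|` times it is
at most both `4 / π` and `1 / (2 δ (1 - s))`. Integrating over `s` produces the logarithm
(`norm_integral_le_log`), with a margin: for `x ≥ 1`, `2 δ |f (x + 1) - f x| ≤ log⁺ (π δ) + 4 / π²`.

Since `f 0 = 0` is only a convention, the increment at `0` is `f 1` and needs its own argument: the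
equation at `0` fixes a weighted sum of the `f j`, and the other increments control `f j - f 1`.
This uses the margin and `δ ≤ ∑ j (2 - j) λ_j`.

For the reliability rates, `L'` is a nonnegative combination of `(1 + p (w - 1)) ^ m`, `m = 2, 3,
4`, `p = q ^ k`, so dissipativity reduces to estimating `Re (ζ (1 + ρ ζ) ^ m)` for `ζ = e^{iθ} - 1`
and `0 ≤ ρ ≤ 1/4`. -/

noncomputable section

open Complex (I)

/-! ### Fourier coefficients on the unit circle. -/

/-- The `a`-th Fourier coefficient of the restriction of `F` to the unit circle. -/
def circleCoeff (a : ℤ) (F : ℂ → ℂ) : ℂ :=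
  (2 * Real.pi : ℂ)⁻¹ * ∫ θ in (0 : ℝ)..2 * Real.pi,
    Complex.exp (-(a * θ * I)) * F (Complex.exp (θ * I))

lemma circleCoeff_sub (a : ℤ) {F H : ℂ → ℂ} (hF : Continuous F) (hH : Continuous H) :
    circleCoeff a (fun z => F z - H z) = circleCoeff a F - circleCoeff a H := by
  unfold circleCoeff
  rw [← mul_sub, ← intervalIntegral.integral_sub]
  · simp only [mul_sub]
  · apply Continuous.intervalIntegrable; fun_prop
  · apply Continuous.intervalIntegrable; fun_prop

lemma circleCoeff_const_mul (a : ℤ) (c : ℂ) (F : ℂ → ℂ) :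
    circleCoeff a (fun z => c * F z) = c * circleCoeff a F := by
  unfold circleCoeff
  rw [mul_left_comm, ← intervalIntegral.integral_const_mul c]
  simp only [mul_left_comm c]

lemma circleCoeff_finset_sum (a : ℤ) {ι : Type*} (s : Finset ι) {F : ι → ℂ → ℂ}
    (hF : ∀ i, Continuous (F i)) :
    circleCoeff a (fun z => ∑ i ∈ s, F i z) = ∑ i ∈ s, circleCoeff a (F i) := by
  unfold circleCoeff
  rw [← Finset.mul_sum, ← intervalIntegral.integral_finsetSum]
  · simp only [Finset.mul_sum]
  · intro i _
    have := hF i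
    apply Continuous.intervalIntegrable; fun_prop

/-- Multiplication by `z` shifts the index, so `z - 1` acts as a difference operator; inverting it
gives the cumulative sums needed for `I(· ≤ y)`. -/
lemma circleCoeff_sub_one_mul (a : ℤ) {F : ℂ → ℂ} (hF : Continuous F) :
    circleCoeff a (fun z => (z - 1) * F z) = circleCoeff (a - 1) F - circleCoeff a F := by
  have h : circleCoeff a (fun z => z * F z) = circleCoeff (a - 1) F := by
    unfold circleCoeff
    congr 2
    ext θ
    rw [← mul_assoc, ← Complex.exp_add]
    congr 2
    push_cast
    ring
  rw [← h, ← circleCoeff_sub a (by fun_prop) hF]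
  simp only [sub_mul, one_mul]

/-- Cauchy's theorem. It supplies the starting value for that summation. -/
lemma circleCoeff_neg_one {F : ℂ → ℂ} (hF : Differentiable ℂ F) : circleCoeff (-1) F = 0 := by
  have h := Complex.circleIntegral_eq_zero_of_differentiable_on_off_countable (R := 1) (c := 0)
    zero_le_one (s := ∅) Set.countable_empty hF.continuous.continuousOn
    (fun z _ => hF.differentiableAt)
  rw [circleIntegral] at h
  have h2 : (∫ θ in (0 : ℝ)..2 * Real.pi, I * (Complex.exp (-((-1 : ℤ) * θ * I)) *
      F (Complex.exp (θ * I)))) = 0 := by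
    rw [← h]
    congr 1
    ext θ
    simp [circleMap]
    ring
  rw [intervalIntegral.integral_const_mul] at h2
  rw [circleCoeff, (mul_eq_zero.1 h2).resolve_left Complex.I_ne_zero, mul_zero]

lemma circleCoeff_pow (a : ℤ) (x : ℕ) :
    circleCoeff a (fun z => z ^ x) = if a = x then 1 else 0 := by
  have h : circleCoeff a (fun z => z ^ x) = (2 * Real.pi : ℂ)⁻¹ *
      ∫ θ in (0 : ℝ)..2 * Real.pi, Complex.exp ((((x : ℤ) - a : ℤ) : ℂ) * I * θ) := by
    unfold circleCoeff
    congr 2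
    ext θ
    simp only [← Complex.exp_nat_mul, ← Complex.exp_add]
    congr 1
    push_cast
    ring
  rw [h]
  have hpi : (Real.pi : ℂ) ≠ 0 := by exact_mod_cast Real.pi_ne_zero
  split_ifs with hax
  · rw [hax]
    simp
    field_simp
  · have hne : ((x : ℤ) - a : ℤ) ≠ 0 := by omega
    have hne' : (((x : ℤ) - a : ℤ) : ℂ) * I ≠ 0 :=
      mul_ne_zero (by exact_mod_cast hne) Complex.I_ne_zero
    rw [integral_exp_mul_complex hne']
    have : Complex.exp ((((x : ℤ) - a : ℤ) : ℂ) * I * (2 * Real.pi : ℝ)) = 1 := by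
      rw [Complex.exp_eq_one_iff]
      exact ⟨(x : ℤ) - a, by push_cast; ring⟩
    rw [this]
    simp

lemma norm_circleCoeff_le (a : ℤ) {F : ℂ → ℂ} {B : ℝ → ℝ}
    (hB : IntervalIntegrable B volume 0 (2 * Real.pi))
    (h : ∀ θ : ℝ, ‖F (Complex.exp (θ * I))‖ ≤ B θ) :
    ‖circleCoeff a F‖ ≤ (2 * Real.pi)⁻¹ * ∫ θ in (0 : ℝ)..2 * Real.pi, B θ := by
  unfold circleCoeff
  rw [norm_mul]
  have h1 : ‖(2 * Real.pi : ℂ)⁻¹‖ = (2 * Real.pi)⁻¹ := by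
    simp [abs_of_pos Real.pi_pos]
  rw [h1]
  gcongr
  apply intervalIntegral.norm_integral_le_of_norm_le (by positivity) _ hB
  refine Filter.Eventually.of_forall fun θ _ => ?_
  rw [norm_mul]
  have h2 : ‖Complex.exp (-(a * θ * I))‖ = 1 := by
    have := Complex.norm_exp_ofReal_mul_I (-(a * θ))
    rw [← this]; congr 2; push_cast; ring
  rw [h2, one_mul]
  exact h θ

lemma continuous_circleCoeff (a : ℤ) {F : ℝ → ℂ → ℂ} (hF : Continuous (fun p : ℝ × ℂ => F p.1 p.2)) :
    Continuous fun s => circleCoeff a (F s) := by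
  unfold circleCoeff
  apply Continuous.mul continuous_const
  apply intervalIntegral.continuous_parametric_intervalIntegral_of_continuous'
  have : Continuous (fun p : ℝ × ℝ => F p.1 (Complex.exp (p.2 * I))) :=
    hF.comp (by fun_prop : Continuous fun p : ℝ × ℝ => (p.1, Complex.exp (p.2 * I)))
  unfold Function.uncurry
  fun_prop

lemma integral_circleCoeff (a : ℤ) {F : ℝ → ℂ → ℂ}
    (hF : Continuous (fun p : ℝ × ℂ => F p.1 p.2)) (u v : ℝ) :
    ∫ s in u..v, circleCoeff a (F s) = circleCoeff a (fun z => ∫ s in u..v, F s z) := by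
  unfold circleCoeff
  rw [intervalIntegral.integral_const_mul, intervalIntegral_intervalIntegral_swap]
  · simp only [intervalIntegral.integral_const_mul]
  · apply (Continuous.continuousOn _).integrableOn_compact (μ := volume)
      (isCompact_uIcc.prod isCompact_uIcc) |>.mono_set
    · exact Set.prod_mono Set.uIoc_subset_uIcc Set.uIoc_subset_uIcc
    · have : Continuous (fun p : ℝ × ℝ => F p.1 (Complex.exp (p.2 * I))) :=
        hF.comp (by fun_prop : Continuous fun p : ℝ × ℝ => (p.1, Complex.exp (p.2 * I)))
      unfold Function.uncurry
      fun_prop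

/-! ### Compound Poisson laws and their generating functions. -/

/-- A finitely supported family of nonnegative clump rates, with positive total rate. -/
structure IsClumpRate (J : ℕ) (lam : ℕ → ℝ) : Prop where
  nonneg : ∀ j, 0 ≤ lam j
  zero : lam 0 = 0
  support : ∀ j, J ≤ j → lam j = 0
  pos : 0 < ∑ j ∈ Finset.range J, lam j

/-- The logarithm of the probability generating function of a compound Poisson distribution. -/
def logPgf (J : ℕ) (lam : ℕ → ℝ) (z : ℂ) : ℂ := ∑ j ∈ Finset.range J, (lam j : ℂ) * (z ^ j - 1)

namespace IsClumpRate
variable {J : ℕ} {lam : ℕ → ℝ}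

lemma totalRate_eq (h : IsClumpRate J lam) : totalRate lam = ∑ j ∈ Finset.range J, lam j := by
  rw [totalRate]
  exact tsum_eq_sum fun j hj => h.support j (by simpa using hj)

lemma totalRate_pos (h : IsClumpRate J lam) : 0 < totalRate lam := by
  rw [h.totalRate_eq]; exact h.pos

lemma isProbabilityMeasure_clumpLaw (h : IsClumpRate J lam) :
    IsProbabilityMeasure (clumpLaw lam) := by
  apply HasSum.isProbabilityMeasure_sum_dirac
  · intro j
    exact div_nonneg (h.nonneg j) h.totalRate_pos.le
  · have : HasSum lam (totalRate lam) := by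
      rw [h.totalRate_eq]
      exact hasSum_sum_of_ne_finset_zero fun j hj => h.support j (by simpa using hj)
    simpa [h.totalRate_pos.ne'] using this.div_const (totalRate lam)

lemma integral_clumpLaw (h : IsClumpRate J lam) (f : ℕ → ℂ) :
    ∫ x, f x ∂(clumpLaw lam) = ∑ j ∈ Finset.range J, ((lam j / totalRate lam : ℝ) : ℂ) * f j := by
  rw [clumpLaw, integral_sum_dirac (by simp), tsum_eq_sum (s := Finset.range J)]
  · refine Finset.sum_congr rfl fun j _ => ?_
    rw [ENNReal.toReal_ofReal (div_nonneg (h.nonneg j) h.totalRate_pos.le)]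
    simp
  · intro j hj
    rw [h.support j (by simpa using hj)]
    simp

lemma isProbabilityMeasure_compoundPoisson (h : IsClumpRate J lam) :
    IsProbabilityMeasure (compoundPoisson lam) := by
  have := h.isProbabilityMeasure_clumpLaw
  rw [compoundPoisson]
  apply isProbabilityMeasure_bind
  · exact (measurable_of_countable _).aemeasurable
  · refine Filter.Eventually.of_forall fun N => ?_
    exact Measure.isProbabilityMeasure_map (measurable_of_countable _).aemeasurable

lemma _root_.compoundPoisson_eq_sum (lam : ℕ → ℝ) : compoundPoisson lam =
    Measure.sum fun N : ℕ => ENNReal.ofReal (Real.exp (-(totalRate lam).toNNReal) *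
      (totalRate lam).toNNReal ^ N / N.factorial) •
        (Measure.pi fun _ : Fin N => clumpLaw lam).map fun x => ∑ i, x i := by
  ext s hs
  rw [compoundPoisson, Measure.bind_apply hs (measurable_of_countable _).aemeasurable,
    poissonMeasure, lintegral_sum_measure, Measure.sum_apply _ hs]
  simp [lintegral_smul_measure]

lemma integral_clumpLaw_sum_pow (h : IsClumpRate J lam) (z : ℂ) (N : ℕ) :
    ∫ u, z ^ u ∂((Measure.pi fun _ : Fin N => clumpLaw lam).map fun x => ∑ i, x i) =
      (∫ x, z ^ x ∂(clumpLaw lam)) ^ N := by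
  have := h.isProbabilityMeasure_clumpLaw
  rw [integral_map (measurable_of_countable _).aemeasurable (by fun_prop)]
  simp only [← Finset.prod_pow_eq_pow_sum]
  rw [integral_fintype_prod_eq_pow (fun x : ℕ => z ^ x)]
  simp

lemma integrable_pow (μ : Measure ℕ) [IsFiniteMeasure μ] {z : ℂ} (hz : ‖z‖ ≤ 1) :
    Integrable (fun u : ℕ => z ^ u) μ := by
  refine Integrable.of_bound (by fun_prop) 1 (Filter.Eventually.of_forall fun u => ?_)
  rw [norm_pow]
  exact pow_le_one₀ (norm_nonneg _) hz

lemma integral_compoundPoisson_pow (h : IsClumpRate J lam) {z : ℂ} (hz : ‖z‖ ≤ 1) :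
    ∫ u, z ^ u ∂(compoundPoisson lam) = Complex.exp (logPgf J lam z) := by
  have := h.isProbabilityMeasure_clumpLaw
  have := h.isProbabilityMeasure_compoundPoisson
  have hint := integrable_pow (compoundPoisson lam) hz
  set φ : ℂ := ∫ x, z ^ x ∂(clumpLaw lam) with hφ
  have hlog : logPgf J lam z = totalRate lam * φ - totalRate lam := by
    have h0 : (totalRate lam : ℂ) ≠ 0 := by exact_mod_cast h.totalRate_pos.ne'
    rw [hφ, h.integral_clumpLaw, logPgf, Finset.mul_sum]
    nth_rw 3 [h.totalRate_eq]
    push_cast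
    rw [← Finset.sum_sub_distrib]
    refine Finset.sum_congr rfl fun j _ => ?_
    field_simp
  rw [compoundPoisson_eq_sum] at hint ⊢
  rw [integral_sum_measure hint]
  simp_rw [integral_smul_measure, h.integral_clumpLaw_sum_pow z, ← hφ]
  have hs := (NormedSpace.expSeries_div_hasSum_exp (totalRate lam * φ)).mul_left
    (Complex.exp (-totalRate lam))
  rw [← Complex.exp_eq_exp_ℂ, ← Complex.exp_add] at hs
  rw [hlog, sub_eq_neg_add, ← hs.tsum_eq]
  refine tsum_congr fun N => ?_
  rw [ENNReal.toReal_ofReal (by positivity), Real.coe_toNNReal _ h.totalRate_pos.le]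
  simp only [Complex.real_smul]
  push_cast
  rw [mul_pow]
  ring

end IsClumpRate

/-- The derivative of `logPgf`. -/
def logPgfDeriv (J : ℕ) (lam : ℕ → ℝ) (w : ℂ) : ℂ :=
  ∑ j ∈ Finset.range J, ((j * lam j : ℝ) : ℂ) * w ^ (j - 1)

lemma hasDerivAt_logPgf (J : ℕ) (lam : ℕ → ℝ) (w : ℂ) :
    HasDerivAt (logPgf J lam) (logPgfDeriv J lam w) w := by
  unfold logPgf logPgfDeriv
  apply HasDerivAt.fun_sum
  intro j _
  refine (((hasDerivAt_pow j w).sub_const 1).const_mul (lam j : ℂ)).congr_deriv ?_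
  push_cast
  ring

lemma differentiable_logPgf (J : ℕ) (lam : ℕ → ℝ) : Differentiable ℂ (logPgf J lam) :=
  fun w => (hasDerivAt_logPgf J lam w).differentiableAt

@[fun_prop]
lemma continuous_logPgf (J : ℕ) (lam : ℕ → ℝ) : Continuous (logPgf J lam) :=
  (differentiable_logPgf J lam).continuous

@[simp]
lemma logPgf_one (J : ℕ) (lam : ℕ → ℝ) : logPgf J lam 1 = 0 := by simp [logPgf]

lemma norm_exp_real_mul_I (θ : ℝ) : ‖Complex.exp (θ * I)‖ = 1 := Complex.norm_exp_ofReal_mul_I θ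

lemma IsClumpRate.circleCoeff_exp_logPgf {J : ℕ} {lam : ℕ → ℝ} (h : IsClumpRate J lam) (a : ℕ) :
    circleCoeff a (fun z => Complex.exp (logPgf J lam z)) =
      (compoundPoisson lam).real {a} := by
  have := h.isProbabilityMeasure_compoundPoisson
  have : IsFiniteMeasure ((volume : Measure ℝ).restrict (Set.uIoc 0 (2 * Real.pi))) :=
    inferInstanceAs (IsFiniteMeasure (volume.restrict (Set.Ioc _ _)))
  have h1 : circleCoeff a (fun z => Complex.exp (logPgf J lam z)) =
      ∫ u, circleCoeff a (fun z => z ^ u) ∂(compoundPoisson lam) := by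
    unfold circleCoeff
    rw [integral_const_mul, ← intervalIntegral_integral_swap]
    · congr 2
      ext θ
      simp only [← h.integral_compoundPoisson_pow (norm_exp_real_mul_I θ).le, integral_const_mul]
    · refine Integrable.of_bound ?_ 1 (Filter.Eventually.of_forall fun p => ?_)
      · apply Continuous.aestronglyMeasurable
        have : Continuous (fun n : ℕ => (n : ℂ)) := continuous_of_discreteTopology
        simp only [Function.uncurry_def, ← Complex.exp_nat_mul]
        fun_prop
      · simp only [Function.uncurry_def, norm_mul, norm_pow, norm_exp_real_mul_I, one_pow, mul_one]
        rw [Complex.norm_exp]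
        simp
  rw [h1]
  simp only [circleCoeff_pow]
  have : (fun u : ℕ => if ((a : ℤ) = u) then (1 : ℂ) else 0) =
      Set.indicator {a} (fun _ => (1 : ℂ)) := by
    ext u
    by_cases hu : u = a
    · simp [hu]
    · have : ¬ (a = u) := fun h => hu h.symm
      simp [hu, this]
  rw [this, integral_indicator_const _ (measurableSet_singleton a)]
  simp

lemma integral_kolmogorovTest (μ : Measure ℕ) [IsFiniteMeasure μ] (y : ℕ) :
    ∫ u, kolmogorovTest y u ∂μ = ∑ a ∈ Finset.range (y + 1), μ.real {a} := by
  unfold kolmogorovTest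
  rw [integral_indicator_one measurableSet_Iic]
  have : (Set.Iic y : Set ℕ) = ↑(Finset.range (y + 1)) := by
    ext u; simp
  rw [this, sum_measureReal_singleton]

/-! ### Existence: the Fourier representation of the Stein solution. -/

/-- The integrand in the Fourier representation of the solutions of the Stein equation. -/
def steinKernel (J : ℕ) (lam : ℕ → ℝ) (x : ℕ) (s : ℝ) (z : ℂ) : ℂ :=
  -- At `x = 0` the exponent truncates to `0`; this is harmless, because in the Stein operator that
  -- value only occurs with coefficient `0`.
  (1 + s * (z - 1)) ^ (x - 1) * Complex.exp (logPgf J lam z - logPgf J lam (1 + s * (z - 1)))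

lemma continuous_steinKernel (J : ℕ) (lam : ℕ → ℝ) (x : ℕ) :
    Continuous fun p : ℝ × ℂ => steinKernel J lam x p.1 p.2 := by
  unfold steinKernel
  fun_prop

lemma differentiable_steinKernel (J : ℕ) (lam : ℕ → ℝ) (x : ℕ) (s : ℝ) :
    Differentiable ℂ (steinKernel J lam x s) := by
  have h1 : Differentiable ℂ (fun z : ℂ => 1 + (s : ℂ) * (z - 1)) := by fun_prop
  have h2 := differentiable_logPgf J lam
  exact (h1.pow _).mul ((h2.sub (h2.comp h1)).cexp)

/-- The solution of the Stein equation for the test function `z ^ x`, divided by `1 - z`. -/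
def steinTransform (J : ℕ) (lam : ℕ → ℝ) (x : ℕ) (z : ℂ) : ℂ :=
  ∫ s in (0 : ℝ)..1, steinKernel J lam x s z

@[fun_prop]
lemma continuous_steinTransform (J : ℕ) (lam : ℕ → ℝ) (x : ℕ) :
    Continuous (steinTransform J lam x) := by
  unfold steinTransform
  apply intervalIntegral.continuous_parametric_intervalIntegral_of_continuous'
  exact (continuous_steinKernel J lam x).comp continuous_swap

lemma circleCoeff_steinTransform (J : ℕ) (lam : ℕ → ℝ) (x : ℕ) (a : ℤ) :
    circleCoeff a (steinTransform J lam x) =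
      ∫ s in (0 : ℝ)..1, circleCoeff a (steinKernel J lam x s) :=
  (integral_circleCoeff a (continuous_steinKernel J lam x) 0 1).symm

lemma circleCoeff_neg_one_steinTransform (J : ℕ) (lam : ℕ → ℝ) (x : ℕ) :
    circleCoeff (-1) (steinTransform J lam x) = 0 := by
  rw [circleCoeff_steinTransform]
  simp [circleCoeff_neg_one (differentiable_steinKernel J lam x _)]

/-- The Stein operator applied to `steinTransform`. -/
def steinOperatorTransform (J : ℕ) (lam : ℕ → ℝ) (x : ℕ) (z : ℂ) : ℂ :=
  ∑ j ∈ Finset.range J, ((j * lam j : ℝ) : ℂ) * steinTransform J lam (x + j) z -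
    x * steinTransform J lam x z

lemma continuous_steinOperatorTransform (J : ℕ) (lam : ℕ → ℝ) (x : ℕ) :
    Continuous (steinOperatorTransform J lam x) := by
  unfold steinOperatorTransform
  fun_prop

lemma circleCoeff_steinOperatorTransform (J : ℕ) (lam : ℕ → ℝ) (x : ℕ) (a : ℤ) :
    circleCoeff a (steinOperatorTransform J lam x) =
      ∑ j ∈ Finset.range J, ((j * lam j : ℝ) : ℂ) * circleCoeff a (steinTransform J lam (x + j)) -
        x * circleCoeff a (steinTransform J lam x) := by
  unfold steinOperatorTransform
  rw [circleCoeff_sub a (by fun_prop) (by fun_prop),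
    circleCoeff_finset_sum a _ (fun i => by fun_prop), circleCoeff_const_mul]
  simp only [circleCoeff_const_mul]

/-- With `w = 1 + s (z - 1)`, the integrand times `z - 1` is the `s`-derivative of `-w ^ x * exp (L
z - L w)`; the endpoints are `w = 1`, where `L` vanishes, and `w = z`. -/
lemma sub_one_mul_steinOperatorTransform (J : ℕ) (lam : ℕ → ℝ) (x : ℕ) (z : ℂ) :
    (z - 1) * steinOperatorTransform J lam x z = Complex.exp (logPgf J lam z) - z ^ x := by
  have hc : ∀ x, Continuous fun s : ℝ => steinKernel J lam x s z := fun x =>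
    (continuous_steinKernel J lam x).comp (by fun_prop : Continuous fun s : ℝ => (s, z))
  have hderiv : ∀ s : ℝ, HasDerivAt
      (fun s : ℝ => -((1 + s * (z - 1)) ^ x *
        Complex.exp (logPgf J lam z - logPgf J lam (1 + s * (z - 1)))))
      ((z - 1) * (∑ j ∈ Finset.range J, ((j * lam j : ℝ) : ℂ) * steinKernel J lam (x + j) s z -
        x * steinKernel J lam x s z)) s := by
    intro s
    have hw : HasDerivAt (fun s : ℝ => 1 + (s : ℂ) * (z - 1)) (z - 1) s := by
      simpa using (((hasDerivAt_id s).ofReal_comp).mul_const (z - 1)).const_add 1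
    have hL := (hasDerivAt_logPgf J lam (1 + s * (z - 1))).comp s hw
    have := ((hw.pow x).mul ((hL.const_sub (logPgf J lam z)).cexp)).neg
    refine this.congr_deriv ?_
    simp only [Function.comp_apply, Pi.pow_apply]
    have hsum : ∑ j ∈ Finset.range J, ((j * lam j : ℝ) : ℂ) * steinKernel J lam (x + j) s z =
        (1 + s * (z - 1)) ^ x * logPgfDeriv J lam (1 + s * (z - 1)) *
          Complex.exp (logPgf J lam z - logPgf J lam (1 + s * (z - 1))) := by
      unfold logPgfDeriv
      rw [Finset.mul_sum, Finset.sum_mul]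
      refine Finset.sum_congr rfl fun j _ => ?_
      rcases Nat.eq_zero_or_pos j with rfl | hj
      · simp
      · rw [steinKernel, Nat.add_sub_assoc hj, pow_add]
        ring
    rw [hsum, steinKernel]
    ring
  have hFTC := intervalIntegral.integral_eq_sub_of_hasDerivAt (a := 0) (b := 1)
    (fun s _ => hderiv s) (by
      apply Continuous.intervalIntegrable
      have := hc
      fun_prop)
  unfold steinOperatorTransform steinTransform
  rw [intervalIntegral.integral_const_mul, intervalIntegral.integral_sub,
    intervalIntegral.integral_finsetSum, intervalIntegral.integral_const_mul] at hFTC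
  · simp only [intervalIntegral.integral_const_mul] at hFTC
    rw [hFTC]
    simp
    ring
  · intro i _
    have := hc
    apply Continuous.intervalIntegrable
    fun_prop
  · have := hc
    apply Continuous.intervalIntegrable
    fun_prop
  · have := hc
    apply Continuous.intervalIntegrable
    fun_prop

/-- Dividing `exp (L z) - z ^ x` by `z - 1` telescopes upwards from the coefficient of index `-1`,
which is zero, and leaves partial sums of point masses. -/
lemma IsClumpRate.circleCoeff_steinOperatorTransform {J : ℕ} {lam : ℕ → ℝ}
    (h : IsClumpRate J lam) (x y : ℕ) :
    circleCoeff y (steinOperatorTransform J lam x) =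
      ((kolmogorovTest y x - ∫ u, kolmogorovTest y u ∂(compoundPoisson lam) : ℝ) : ℂ) := by
  have := h.isProbabilityMeasure_compoundPoisson
  have hstep : ∀ a : ℕ, circleCoeff a (steinOperatorTransform J lam x) =
      circleCoeff ((a : ℤ) - 1) (steinOperatorTransform J lam x) +
        ((if a = x then 1 else 0) - ((compoundPoisson lam).real {a} : ℂ)) := by
    intro a
    have h1 := circleCoeff_sub_one_mul a (continuous_steinOperatorTransform J lam x)
    simp only [sub_one_mul_steinOperatorTransform] at h1
    rw [circleCoeff_sub _ (by fun_prop) (by fun_prop), h.circleCoeff_exp_logPgf,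
      circleCoeff_pow] at h1
    simp only [Nat.cast_inj] at h1
    linear_combination h1
  have hneg : circleCoeff (-1) (steinOperatorTransform J lam x) = 0 := by
    rw [_root_.circleCoeff_steinOperatorTransform]
    simp [circleCoeff_neg_one_steinTransform]
  have hsum : circleCoeff y (steinOperatorTransform J lam x) =
      ∑ a ∈ Finset.range (y + 1),
        ((if a = x then 1 else 0) - ((compoundPoisson lam).real {a} : ℂ)) := by
    induction y with
    | zero =>
      rw [hstep 0]
      simp [hneg, eq_comm]
    | succ y ih =>
      rw [hstep (y + 1), Finset.sum_range_succ, ← ih]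
      congr 2
      push_cast
      ring
  rw [hsum, integral_kolmogorovTest, Finset.sum_sub_distrib]
  push_cast
  congr 1
  rw [Finset.sum_ite_eq']
  simp only [kolmogorovTest, Set.indicator, Finset.mem_range, Set.mem_Iic, Nat.lt_succ_iff]
  split_ifs <;> simp

/-- The solution of the Stein equation for the test function `I(· ≤ y)`. -/
def steinSolution (J : ℕ) (lam : ℕ → ℝ) (y x : ℕ) : ℝ :=
  if x = 0 then 0 else (circleCoeff y (steinTransform J lam x)).re

lemma IsClumpRate.tsum_eq {J : ℕ} {lam : ℕ → ℝ} (h : IsClumpRate J lam) (g : ℕ → ℝ) :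
    ∑' j : ℕ, (j : ℝ) * lam j * g j = ∑ j ∈ Finset.range J, (j : ℝ) * lam j * g j :=
  tsum_eq_sum fun j hj => by rw [h.support j (by simpa using hj)]; simp

lemma IsClumpRate.steinSolution_equation {J : ℕ} {lam : ℕ → ℝ} (h : IsClumpRate J lam)
    (y x : ℕ) :
    kolmogorovTest y x - ∫ u, kolmogorovTest y u ∂(compoundPoisson lam) =
      (∑' j : ℕ, (j : ℝ) * lam j * steinSolution J lam y (x + j)) -
        (x : ℝ) * steinSolution J lam y x := by
  have h1 := congrArg Complex.re (h.circleCoeff_steinOperatorTransform x y)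
  rw [Complex.ofReal_re] at h1
  rw [← h1, h.tsum_eq, _root_.circleCoeff_steinOperatorTransform, Complex.sub_re, Complex.re_sum]
  congr 1
  · refine Finset.sum_congr rfl fun j _ => ?_
    rcases Nat.eq_zero_or_pos j with rfl | hj
    · simp
    · rw [Complex.re_ofReal_mul, steinSolution, if_neg (by omega)]
  · rcases Nat.eq_zero_or_pos x with rfl | hx
    · simp
    · rw [steinSolution, if_neg (by omega)]
      simp

/-! ### Uniqueness. -/

/-- Far out, the homogeneous equation at least halves any bound on the difference of two solutions,
so the bounded difference vanishes there; the equation then determines values downwards to `x = 1`.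
-/
lemma IsSteinSolution.unique {J : ℕ} {lam : ℕ → ℝ} (hl : IsClumpRate J lam) {h f g : ℕ → ℝ}
    (hf : IsSteinSolution lam h f) (hg : IsSteinSolution lam h g) : f = g := by
  obtain ⟨C₁, hC₁⟩ := hf.bounded
  obtain ⟨C₂, hC₂⟩ := hg.bounded
  set L : ℝ := ∑ j ∈ Finset.range J, (j : ℝ) * lam j with hL
  have hnn : ∀ j : ℕ, 0 ≤ (j : ℝ) * lam j := fun j => mul_nonneg (by positivity) (hl.nonneg j)
  have heq : ∀ x : ℕ, (x : ℝ) * (f x - g x) =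
      ∑ j ∈ Finset.range J, (j : ℝ) * lam j * (f (x + j) - g (x + j)) := by
    intro x
    have h1 := hf.equation x
    have h2 := hg.equation x
    rw [hl.tsum_eq (fun j => f (x + j))] at h1
    rw [hl.tsum_eq (fun j => g (x + j))] at h2
    simp only [mul_sub, Finset.sum_sub_distrib]
    linarith
  have hbound : ∀ (x : ℕ) (B : ℝ), (∀ z, x ≤ z → |f z - g z| ≤ B) →
      (x : ℝ) * |f x - g x| ≤ L * B := by
    intro x B hB
    calc (x : ℝ) * |f x - g x| = |(x : ℝ) * (f x - g x)| := by rw [abs_mul, Nat.abs_cast]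
      _ ≤ ∑ j ∈ Finset.range J, |(j : ℝ) * lam j * (f (x + j) - g (x + j))| := by
        rw [heq]; exact Finset.abs_sum_le_sum_abs _ _
      _ ≤ ∑ j ∈ Finset.range J, (j : ℝ) * lam j * B := by
        refine Finset.sum_le_sum fun j _ => ?_
        rw [abs_mul, abs_of_nonneg (hnn j)]
        exact mul_le_mul_of_nonneg_left (hB _ (by omega)) (hnn j)
      _ = L * B := by rw [Finset.sum_mul]
  obtain ⟨X, hX⟩ := exists_nat_ge (2 * L + 1)
  have hL0 : 0 ≤ L := Finset.sum_nonneg fun j _ => hnn j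
  have hgeom : ∀ (m x : ℕ), X ≤ x → |f x - g x| ≤ (C₁ + C₂) * (1 / 2) ^ m := by
    intro m
    induction m with
    | zero =>
      intro x _
      have := abs_sub (f x) (g x)
      have := hC₁ x
      have := hC₂ x
      simp
      linarith
    | succ m ih =>
      intro x hx
      have h1 := hbound x _ fun z hz => ih z (hx.trans hz)
      have h2 : (2 * L + 1 : ℝ) ≤ x := hX.trans (by exact_mod_cast hx)
      have h3 := abs_nonneg (f X - g X)
      have h4 := ih x hx
      have h5 := (abs_nonneg (f x - g x)).trans h4
      rw [pow_succ]
      have h6 : (2 * L + 1) * |f x - g x| ≤ L * ((C₁ + C₂) * (1 / 2) ^ m) :=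
        (mul_le_mul_of_nonneg_right h2 (abs_nonneg _)).trans h1
      nlinarith [abs_nonneg (f x - g x)]
  have hlarge : ∀ x, X ≤ x → f x - g x = 0 := by
    intro x hx
    have hlim : Filter.Tendsto (fun m : ℕ => (C₁ + C₂) * (1 / 2 : ℝ) ^ m) Filter.atTop
        (nhds 0) := by
      simpa using (tendsto_pow_atTop_nhds_zero_of_lt_one (r := (1 / 2 : ℝ)) (by norm_num)
        (by norm_num)).const_mul (C₁ + C₂)
    exact abs_nonpos_iff.1 (ge_of_tendsto' hlim fun m => hgeom m x hx)
  have hall : ∀ k x : ℕ, 1 ≤ x → X ≤ x + k → f x - g x = 0 := by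
    intro k
    induction k with
    | zero => exact fun x _ hx => hlarge x hx
    | succ k ih =>
      intro x hx hxk
      have h1 : (x : ℝ) * (f x - g x) = 0 := by
        rw [heq]
        refine Finset.sum_eq_zero fun j _ => ?_
        rcases Nat.eq_zero_or_pos j with rfl | hj
        · simp
        · rw [ih (x + j) (by omega) (by omega), mul_zero]
      have hx0 : (x : ℝ) ≠ 0 := by exact_mod_cast (by omega : x ≠ 0)
      exact (mul_eq_zero.1 h1).resolve_left hx0
  ext x
  rcases Nat.eq_zero_or_pos x with rfl | hx
  · rw [hf.zero, hg.zero]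
  · exact sub_eq_zero.1 (hall X x hx (by omega))

/-! ### Dissipativity and bounds on the kernel. -/

/-- The negativity condition on the rates under which the Stein solutions are controlled. -/
def IsDissipative (J : ℕ) (lam : ℕ → ℝ) (δ : ℝ) : Prop :=
  ∀ r ∈ Set.Icc (0 : ℝ) 1, ∀ θ : ℝ,
    ((Complex.exp (θ * I) - 1) * logPgfDeriv J lam (1 + r * (Complex.exp (θ * I) - 1))).re ≤
      -(δ * (1 - Real.cos θ))

/-- Dissipativity bounds the derivative of `Re L` along the segment from `1` to `z`; integrate it
over `[s, 1]`. -/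
lemma IsDissipative.re_logPgf_sub_le {J : ℕ} {lam : ℕ → ℝ} {δ : ℝ} (hd : IsDissipative J lam δ)
    {s : ℝ} (hs : s ∈ Set.Icc (0 : ℝ) 1) (θ : ℝ) :
    (logPgf J lam (Complex.exp (θ * I)) -
      logPgf J lam (1 + s * (Complex.exp (θ * I) - 1))).re ≤ -(δ * (1 - s) * (1 - Real.cos θ)) := by
  set z := Complex.exp (θ * I) with hz
  have hderiv : ∀ r : ℝ, HasDerivAt
      (fun r : ℝ => (logPgf J lam (1 + r * (z - 1))).re + δ * (1 - Real.cos θ) * r)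
      (((z - 1) * logPgfDeriv J lam (1 + r * (z - 1))).re + δ * (1 - Real.cos θ)) r := by
    intro r
    have hw : HasDerivAt (fun s : ℝ => 1 + (s : ℂ) * (z - 1)) (z - 1) r := by
      simpa using (((hasDerivAt_id r).ofReal_comp).mul_const (z - 1)).const_add 1
    have hL := (hasDerivAt_logPgf J lam (1 + r * (z - 1))).comp r hw
    have h2 := (Complex.reCLM.hasFDerivAt.comp_hasDerivAt r hL).add
      ((hasDerivAt_id r).const_mul (δ * (1 - Real.cos θ)))
    refine h2.congr_deriv ?_
    rw [mul_comm (logPgfDeriv _ _ _)]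
    simp
  have hanti := antitoneOn_of_deriv_nonpos (convex_Icc (0 : ℝ) 1)
    (fun r _ => (hderiv r).continuousAt.continuousWithinAt)
    (fun r _ => (hderiv r).differentiableAt.differentiableWithinAt)
    (fun r hr => by
      rw [(hderiv r).deriv]
      have := hd r (interior_subset hr) θ
      linarith)
  have := hanti hs (Set.right_mem_Icc.2 zero_le_one) hs.2
  simp only [Complex.ofReal_one, one_mul, add_sub_cancel, mul_one] at this
  rw [Complex.sub_re]
  linarith

lemma norm_segment_le_one {s : ℝ} (hs : s ∈ Set.Icc (0 : ℝ) 1) {z : ℂ} (hz : ‖z‖ ≤ 1) :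
    ‖1 + s * (z - 1)‖ ≤ 1 := by
  have h1 : (1 + s * (z - 1) : ℂ) = ((1 - s : ℝ) : ℂ) + (s : ℂ) * z := by push_cast; ring
  rw [h1]
  refine (norm_add_le _ _).trans ?_
  rw [norm_mul, Complex.norm_real, Complex.norm_real, Real.norm_of_nonneg hs.1,
    Real.norm_of_nonneg (sub_nonneg.2 hs.2)]
  nlinarith [hs.1]

lemma IsDissipative.norm_steinKernel_le {J : ℕ} {lam : ℕ → ℝ} {δ : ℝ}
    (hd : IsDissipative J lam δ) (x : ℕ) {s : ℝ} (hs : s ∈ Set.Icc (0 : ℝ) 1) (θ : ℝ) :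
    ‖steinKernel J lam x s (Complex.exp (θ * I))‖ ≤
      Real.exp (-(δ * (1 - s) * (1 - Real.cos θ))) := by
  rw [steinKernel, norm_mul, norm_pow, Complex.norm_exp]
  refine (mul_le_of_le_one_left (Real.exp_pos _).le ?_).trans
    (Real.exp_le_exp.2 (hd.re_logPgf_sub_le hs θ))
  exact pow_le_one₀ (norm_nonneg _) (norm_segment_le_one hs (norm_exp_real_mul_I θ).le)

lemma IsDissipative.isSteinSolution {J : ℕ} {lam : ℕ → ℝ} {δ : ℝ} (hl : IsClumpRate J lam)
    (hd : IsDissipative J lam δ) (hδ : 0 < δ) (y : ℕ) :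
    IsSteinSolution lam (kolmogorovTest y) (steinSolution J lam y) where
  bounded := by
    refine ⟨1, fun x => ?_⟩
    unfold steinSolution
    split_ifs
    · simp
    refine (Complex.abs_re_le_norm _).trans ?_
    rw [circleCoeff_steinTransform]
    have := intervalIntegral.norm_integral_le_of_norm_le_const (a := 0) (b := 1) (C := 1)
      (f := fun s => circleCoeff y (steinKernel J lam x s)) (by
        intro s hs
        rw [Set.uIoc_of_le zero_le_one] at hs
        have := norm_circleCoeff_le y (F := steinKernel J lam x s) (B := fun _ => 1)
          (by simp) (fun θ => by
            refine (hd.norm_steinKernel_le x ⟨hs.1.le, hs.2⟩ θ).trans ?_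
            rw [Real.exp_le_one_iff, neg_nonpos]
            have h1 := Real.cos_le_one θ
            have h2 := hs.2
            have : 0 ≤ 1 - s := by linarith
            have : 0 ≤ 1 - Real.cos θ := by linarith
            positivity)
        refine this.trans (le_of_eq ?_)
        simp
        field_simp)
    simpa using this
  zero := by simp [steinSolution]
  equation := hl.steinSolution_equation y

/-! ### Integral estimates. -/

/-- By convexity `w ^ 2` lies below its chords on `[0, 1/2]` and `[1/2, 1]`, which makes both
integrals elementary. The constant `π / 4` is what later yields exactly `1 / (2 b)`. -/
lemma integral_exp_neg_mul_one_sub_sq_le {a : ℝ} (ha : 0 < a) :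
    ∫ w in (0 : ℝ)..1, Real.exp (-(a * (1 - w ^ 2))) ≤ Real.pi / 4 / a := by
  have hi : ∀ u v : ℝ, IntervalIntegrable (fun w : ℝ => Real.exp (-(a * (1 - w ^ 2)))) volume u v :=
    fun u v => by apply Continuous.intervalIntegrable; fun_prop
  rw [← intervalIntegral.integral_add_adjacent_intervals (hi 0 (1 / 2)) (hi (1 / 2) 1)]
  have h1 : ∫ w in (0 : ℝ)..1 / 2, Real.exp (-(a * (1 - w ^ 2))) ≤
      2 / a * (Real.exp (-(a * (3 / 4))) - Real.exp (-a)) := by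
    have hd : ∀ w : ℝ, HasDerivAt (fun w => 2 / a * Real.exp (-(a * (1 - w / 2))))
        (Real.exp (-(a * (1 - w / 2)))) w := by
      intro w
      have := ((((((hasDerivAt_id w).div_const 2).const_sub 1).const_mul a).neg).exp).const_mul
        (2 / a)
      refine this.congr_deriv ?_
      simp only [id, Pi.neg_apply]
      field_simp
    have hF := intervalIntegral.integral_eq_sub_of_hasDerivAt (a := 0) (b := 1 / 2)
      (fun w _ => hd w) (by apply Continuous.intervalIntegrable; fun_prop)
    calc _ ≤ ∫ w in (0 : ℝ)..1 / 2, Real.exp (-(a * (1 - w / 2))) := by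
          apply intervalIntegral.integral_mono_on (by norm_num) (hi _ _)
            (by apply Continuous.intervalIntegrable; fun_prop)
          intro w hw
          apply Real.exp_le_exp.2
          nlinarith [mul_nonneg ha.le (mul_nonneg hw.1 (sub_nonneg.2 hw.2))]
      _ = _ := by
          rw [hF]
          norm_num
          ring
  have h2 : ∫ w in (1 / 2 : ℝ)..1, Real.exp (-(a * (1 - w ^ 2))) ≤
      2 / (3 * a) * (1 - Real.exp (-(a * (3 / 4)))) := by
    have hd : ∀ w : ℝ, HasDerivAt (fun w => 2 / (3 * a) * Real.exp (-(a * (3 / 2 * (1 - w)))))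
        (Real.exp (-(a * (3 / 2 * (1 - w))))) w := by
      intro w
      have := (((((((hasDerivAt_id w).const_sub 1).const_mul (3 / 2)).const_mul a).neg).exp)).const_mul
        (2 / (3 * a))
      refine this.congr_deriv ?_
      simp only [id, Pi.neg_apply]
      field_simp
    have hF := intervalIntegral.integral_eq_sub_of_hasDerivAt (a := 1 / 2) (b := 1)
      (fun w _ => hd w) (by apply Continuous.intervalIntegrable; fun_prop)
    calc _ ≤ ∫ w in (1 / 2 : ℝ)..1, Real.exp (-(a * (3 / 2 * (1 - w)))) := by
          apply intervalIntegral.integral_mono_on (by norm_num) (hi _ _)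
            (by apply Continuous.intervalIntegrable; fun_prop)
          intro w hw
          apply Real.exp_le_exp.2
          nlinarith [mul_nonneg ha.le (mul_nonneg (sub_nonneg.2 hw.1) (sub_nonneg.2 hw.2))]
      _ = _ := by
          rw [hF]
          norm_num
          ring
  refine (add_le_add h1 h2).trans ?_
  set t := Real.exp (-(a / 4)) with ht
  have e1 : Real.exp (-(a * (3 / 4))) = t ^ 3 := by
    rw [ht, ← Real.exp_nat_mul]; congr 1; push_cast; ring
  have e2 : Real.exp (-a) = t ^ 4 := by
    rw [ht, ← Real.exp_nat_mul]; congr 1; push_cast; ring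
  rw [e1, e2]
  have ht0 : 0 < t := Real.exp_pos _
  have : 2 / a * (t ^ 3 - t ^ 4) + 2 / (3 * a) * (1 - t ^ 3) =
      (2 / 3 + 4 / 3 * t ^ 3 - 2 * t ^ 4) / a := by
    field_simp; ring
  rw [this]
  gcongr
  -- The numerator is maximal at `t = 1/2`, with value `17/24 < 3/4 < π / 4`; this product is its
  -- distance from the maximum.
  have h3 : 0 ≤ (t - 1 / 2) ^ 2 * (2 * t ^ 2 + 2 / 3 * t + 1 / 6) := by positivity
  nlinarith [Real.pi_gt_three]

/-- Substitute `w = cos (θ / 2)`, so that `1 - cos θ = 2 (1 - w ^ 2)`. -/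
lemma integral_sin_half_mul_exp (b : ℝ) :
    ∫ θ in (0 : ℝ)..2 * Real.pi, 2 * |Real.sin (θ / 2)| * Real.exp (-(b * (1 - Real.cos θ))) =
      8 * ∫ w in (0 : ℝ)..1, Real.exp (-(2 * b * (1 - w ^ 2))) := by
  set g : ℝ → ℝ := fun w => Real.exp (-(2 * b * (1 - w ^ 2))) with hg
  have hgc : Continuous g := by fun_prop
  have h1 : ∫ θ in (0 : ℝ)..2 * Real.pi, 2 * |Real.sin (θ / 2)| *
      Real.exp (-(b * (1 - Real.cos θ))) =
      (-4) * ∫ θ in (0 : ℝ)..2 * Real.pi, (g ∘ fun θ => Real.cos (θ / 2)) θ *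
        (-Real.sin (θ / 2) * (1 / 2)) := by
    rw [← intervalIntegral.integral_const_mul]
    apply intervalIntegral.integral_congr
    intro θ hθ
    rw [Set.uIcc_of_le (by positivity)] at hθ
    have hs : 0 ≤ Real.sin (θ / 2) :=
      Real.sin_nonneg_of_nonneg_of_le_pi (by linarith [hθ.1]) (by linarith [hθ.2])
    have hc : Real.cos θ = 2 * Real.cos (θ / 2) ^ 2 - 1 := by
      rw [← Real.cos_two_mul]; ring_nf
    simp only [hg, Function.comp_apply, abs_of_nonneg hs, hc]
    ring_nf
  have hd : ∀ θ : ℝ, HasDerivAt (fun θ : ℝ => Real.cos (θ / 2))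
      (-Real.sin (θ / 2) * (1 / 2)) θ := fun θ =>
    ((hasDerivAt_id θ).div_const 2).cos
  rw [h1, intervalIntegral.integral_comp_mul_deriv (fun θ _ => hd θ) (by fun_prop) hgc]
  have hi : ∀ u v : ℝ, IntervalIntegrable g volume u v := fun u v => hgc.intervalIntegrable u v
  have h2 : ∫ w in (-1 : ℝ)..0, g w = ∫ w in (0 : ℝ)..1, g w := by
    have := intervalIntegral.integral_comp_neg (a := 0) (b := 1) g
    simp only [neg_zero] at this
    rw [← this]
    simp [hg]
  have h3 := intervalIntegral.integral_add_adjacent_intervals (hi (-1) 0) (hi 0 1)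
  have e1 : (2 * Real.pi / 2) = Real.pi := by ring
  rw [zero_div, e1, Real.cos_zero, Real.cos_pi, intervalIntegral.integral_symm, ← h3, h2]
  ring

/-- The `L¹` norm on the unit circle bounding the increments of point probabilities. -/
lemma average_sin_half_mul_exp_le {b : ℝ} (hb : 0 ≤ b) :
    (2 * Real.pi)⁻¹ * (∫ θ in (0 : ℝ)..2 * Real.pi,
      2 * |Real.sin (θ / 2)| * Real.exp (-(b * (1 - Real.cos θ)))) ≤ 4 / Real.pi := by
  rw [integral_sin_half_mul_exp]
  have h : ∫ w in (0 : ℝ)..1, Real.exp (-(2 * b * (1 - w ^ 2))) ≤ ∫ _ in (0 : ℝ)..1, (1 : ℝ) := by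
    apply intervalIntegral.integral_mono_on zero_le_one
      (by apply Continuous.intervalIntegrable; fun_prop) (by simp)
    intro w hw
    rw [Real.exp_le_one_iff, neg_nonpos]
    have : 0 ≤ 1 - w ^ 2 := by nlinarith [hw.1, hw.2]
    positivity
  rw [intervalIntegral.integral_const, sub_zero, one_smul] at h
  calc _ ≤ (2 * Real.pi)⁻¹ * (8 * 1) := by gcongr
    _ = _ := by field_simp; norm_num

lemma average_sin_half_mul_exp_le_inv {b : ℝ} (hb : 0 < b) :
    (2 * Real.pi)⁻¹ * (∫ θ in (0 : ℝ)..2 * Real.pi,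
      2 * |Real.sin (θ / 2)| * Real.exp (-(b * (1 - Real.cos θ)))) ≤ (2 * b)⁻¹ := by
  rw [integral_sin_half_mul_exp]
  have h := integral_exp_neg_mul_one_sub_sq_le (a := 2 * b) (by positivity)
  calc _ ≤ (2 * Real.pi)⁻¹ * (8 * (Real.pi / 4 / (2 * b))) := by gcongr
    _ = _ := by field_simp; norm_num

/-- Split at `s = 1 - v`: the singular bound is integrated on the left, where it gives `-log v`, and
the uniform one on the right. -/
lemma norm_integral_le_log {E : Type*} [NormedAddCommGroup E] [NormedSpace ℝ E] {g : ℝ → E}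
    (hg : Continuous g) {A δ v : ℝ} (hδ : 0 < δ) (hv : 0 < v) (hv1 : v ≤ 1)
    (h1 : ∀ s, 0 ≤ s → s ≤ 1 → ‖g s‖ ≤ s * A)
    (h2 : ∀ s, 0 ≤ s → s < 1 → ‖g s‖ ≤ s * (2 * (δ * (1 - s)))⁻¹) :
    2 * δ * ‖∫ s in (0 : ℝ)..1, g s‖ ≤
      -Real.log v - 1 + v + 2 * δ * A * (v - v ^ 2 / 2) := by
  have hi : ∀ u w : ℝ, IntervalIntegrable g volume u w := fun u w => hg.intervalIntegrable u w
  have hA : ‖∫ s in (1 - v)..1, g s‖ ≤ A * (v - v ^ 2 / 2) := by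
    refine (intervalIntegral.norm_integral_le_of_norm_le (g := fun s => s * A) (by linarith)
      (Filter.Eventually.of_forall fun s hs => h1 s (by linarith [hs.1]) hs.2)
      (by apply Continuous.intervalIntegrable; fun_prop)).trans (le_of_eq ?_)
    rw [intervalIntegral.integral_mul_const, integral_id]
    ring
  have hB : ‖∫ s in (0 : ℝ)..(1 - v), g s‖ ≤ (2 * δ)⁻¹ * (-Real.log v - 1 + v) := by
    have hd : ∀ s ∈ Set.uIcc 0 (1 - v), HasDerivAt
        (fun s => (2 * δ)⁻¹ * (-Real.log (1 - s) - s)) (s * (2 * (δ * (1 - s)))⁻¹) s := by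
      intro s hs
      rw [Set.uIcc_of_le (by linarith)] at hs
      have hs1 : 0 < 1 - s := by linarith [hs.2]
      have := (((((hasDerivAt_id s).const_sub 1).log hs1.ne').neg).sub
        (hasDerivAt_id s)).const_mul (2 * δ)⁻¹
      refine this.congr_deriv ?_
      simp only [id]
      field_simp
      ring
    have hint : IntervalIntegrable (fun s => s * (2 * (δ * (1 - s)))⁻¹) volume 0 (1 - v) := by
      apply ContinuousOn.intervalIntegrable
      rw [Set.uIcc_of_le (by linarith)]
      apply ContinuousOn.mul continuousOn_id
      apply ContinuousOn.inv₀ (by fun_prop)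
      intro s hs
      have hs1 : 0 < 1 - s := by linarith [hs.2]
      positivity
    refine (intervalIntegral.norm_integral_le_of_norm_le (by linarith)
      (Filter.Eventually.of_forall fun s hs => h2 s hs.1.le (by linarith [hs.2])) hint).trans
      (le_of_eq ?_)
    rw [intervalIntegral.integral_eq_sub_of_hasDerivAt hd hint]
    simp only [sub_sub_cancel, sub_zero, Real.log_one]
    ring
  rw [← intervalIntegral.integral_add_adjacent_intervals (hi 0 (1 - v)) (hi (1 - v) 1)]
  have h3 := (norm_add_le _ _).trans (add_le_add hB hA)
  calc _ ≤ 2 * δ * ((2 * δ)⁻¹ * (-Real.log v - 1 + v) + A * (v - v ^ 2 / 2)) := by gcongr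
    _ = _ := by
      have := hδ.ne'
      rw [mul_add, mul_inv_cancel_left₀ (by positivity)]
      ring

/-! ### Increments of the solution away from the origin. -/

lemma IsDissipative.abs_steinSolution_succ_sub_le {J : ℕ} {lam : ℕ → ℝ} {δ : ℝ}
    (hd : IsDissipative J lam δ) (hδ : 0 < δ) (y : ℕ) {x : ℕ} (hx : 1 ≤ x) :
    2 * δ * |steinSolution J lam y (x + 1) - steinSolution J lam y x| ≤
      Real.posLog (Real.pi * δ) + 4 / Real.pi ^ 2 := by
  set g : ℝ → ℂ := fun s => circleCoeff y (fun z => (z - 1) * (s * steinKernel J lam x s z))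
    with hg
  have hgc : Continuous g := by
    apply continuous_circleCoeff y (F := fun s z => (z - 1) * (s * steinKernel J lam x s z))
    have := continuous_steinKernel J lam x
    fun_prop
  have hdiff : ∀ s z, steinKernel J lam (x + 1) s z - steinKernel J lam x s z =
      (z - 1) * (s * steinKernel J lam x s z) := by
    intro s z
    obtain ⟨n, rfl⟩ := Nat.exists_eq_add_of_le' hx
    simp only [steinKernel, Nat.add_sub_cancel, pow_succ]
    ring
  have hrep : steinSolution J lam y (x + 1) - steinSolution J lam y x =
      (∫ s in (0 : ℝ)..1, g s).re := by
    have hk : ∀ x, Continuous fun s => circleCoeff y (steinKernel J lam x s) := fun x =>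
      continuous_circleCoeff y (continuous_steinKernel J lam x)
    rw [steinSolution, steinSolution, if_neg (by omega), if_neg (by omega), ← Complex.sub_re,
      circleCoeff_steinTransform, circleCoeff_steinTransform, ← intervalIntegral.integral_sub
      ((hk _).intervalIntegrable _ _) ((hk _).intervalIntegrable _ _)]
    congr 2
    ext s
    rw [← circleCoeff_sub _ (differentiable_steinKernel _ _ _ _).continuous
      (differentiable_steinKernel _ _ _ _).continuous]
    simp only [hdiff, hg]
  have hbound : ∀ s, 0 ≤ s → s ≤ 1 → ‖g s‖ ≤ s * ((2 * Real.pi)⁻¹ *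
      ∫ θ in (0 : ℝ)..2 * Real.pi, 2 * |Real.sin (θ / 2)| *
        Real.exp (-(δ * (1 - s) * (1 - Real.cos θ)))) := by
    intro s hs0 hs1
    rw [mul_left_comm, ← intervalIntegral.integral_const_mul]
    apply norm_circleCoeff_le
    · apply Continuous.intervalIntegrable; fun_prop
    · intro θ
      have h1 : ‖Complex.exp (θ * I) - 1‖ = 2 * |Real.sin (θ / 2)| := by
        rw [mul_comm, Complex.norm_exp_I_mul_ofReal_sub_one]
        simp
      rw [norm_mul, norm_mul, h1, Complex.norm_real, Real.norm_of_nonneg hs0, mul_left_comm]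
      gcongr
      exact hd.norm_steinKernel_le x ⟨hs0, hs1⟩ θ
  rw [hrep]
  -- Chosen so that `-log v` is exactly `log⁺ (π δ)`; it is not the point where the two bounds
  -- cross.
  set v : ℝ := min 1 (1 / (Real.pi * δ)) with hv
  have hpδ : 0 < Real.pi * δ := mul_pos Real.pi_pos hδ
  have hv0 : 0 < v := lt_min one_pos (by positivity)
  have hmain := norm_integral_le_log hgc (A := 4 / Real.pi) hδ hv0 (min_le_left _ _)
    (fun s hs0 hs1 => (hbound s hs0 hs1).trans <| mul_le_mul_of_nonneg_left
      (average_sin_half_mul_exp_le (mul_nonneg hδ.le (sub_nonneg.2 hs1))) hs0)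
    (fun s hs0 hs1 => (hbound s hs0 hs1.le).trans <| mul_le_mul_of_nonneg_left
      (average_sin_half_mul_exp_le_inv (mul_pos hδ (sub_pos.2 hs1))) hs0)
  refine (mul_le_mul_of_nonneg_left (Complex.abs_re_le_norm _) (by positivity)).trans
    (hmain.trans ?_)
  have hpi := Real.pi_gt_three
  rcases le_total (Real.pi * δ) 1 with hle | hle
  · have hv' : v = 1 := min_eq_left (by rw [le_div_iff₀ hpδ]; linarith)
    have h0 : 0 ≤ Real.posLog (Real.pi * δ) := Real.posLog_nonneg
    rw [hv']
    simp only [Real.log_one]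
    have : 2 * δ * (4 / Real.pi) * (1 - 1 ^ 2 / 2) = 4 / Real.pi ^ 2 * (Real.pi * δ) := by
      field_simp; norm_num
    rw [this]
    have : 4 / Real.pi ^ 2 * (Real.pi * δ) ≤ 4 / Real.pi ^ 2 * 1 := by gcongr
    linarith
  · have hv' : v = 1 / (Real.pi * δ) := min_eq_right (by rw [div_le_one hpδ]; exact hle)
    have h0 : Real.posLog (Real.pi * δ) = Real.log (Real.pi * δ) :=
      Real.posLog_eq_log (by rwa [abs_of_pos hpδ])
    rw [h0]
    have h1 : 2 * δ * (4 / Real.pi) * (v - v ^ 2 / 2) =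
        8 / Real.pi ^ 2 - 4 / Real.pi ^ 2 * v := by
      rw [hv']; field_simp; ring
    have h2 : -Real.log v = Real.log (Real.pi * δ) := by
      rw [hv', one_div, Real.log_inv, neg_neg]
    rw [h1, h2]
    have hv1 : v ≤ 1 := min_le_left _ _
    have h3 : 4 / Real.pi ^ 2 ≤ 1 := by
      rw [div_le_one (by positivity)]; nlinarith
    have h4 : 8 / Real.pi ^ 2 = 4 / Real.pi ^ 2 + 4 / Real.pi ^ 2 := by ring
    nlinarith

/-! ### The first value of the solution, and the Stein factor. -/

lemma IsClumpRate.measureReal_zero {J : ℕ} {lam : ℕ → ℝ} (hl : IsClumpRate J lam) :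
    (compoundPoisson lam).real {0} = Real.exp (-totalRate lam) := by
  have := hl.isProbabilityMeasure_compoundPoisson
  have h1 := hl.integral_compoundPoisson_pow (z := 0) (by simp)
  have h2 : (fun u : ℕ => (0 : ℂ) ^ u) = Set.indicator {0} (fun _ => (1 : ℂ)) := by
    ext u
    by_cases hu : u = 0 <;> simp [hu]
  have h3 : logPgf J lam 0 = ((-totalRate lam : ℝ) : ℂ) := by
    rw [logPgf, hl.totalRate_eq]
    push_cast
    rw [← Finset.sum_neg_distrib]
    refine Finset.sum_congr rfl fun j _ => ?_
    rcases Nat.eq_zero_or_pos j with rfl | hj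
    · simp [hl.zero]
    · simp [hj.ne']
  rw [h2, integral_indicator_const _ (measurableSet_singleton 0), h3, ← Complex.ofReal_exp] at h1
  simpa [-Complex.ofReal_exp, -Complex.ofReal_neg, Complex.ofReal_inj] using h1

lemma IsClumpRate.abs_one_sub_integral_kolmogorovTest_le {J : ℕ} {lam : ℕ → ℝ}
    (hl : IsClumpRate J lam) (y : ℕ) :
    |1 - ∫ u, kolmogorovTest y u ∂(compoundPoisson lam)| ≤ 1 - Real.exp (-totalRate lam) := by
  have := hl.isProbabilityMeasure_compoundPoisson
  have h1 : ∫ u, kolmogorovTest y u ∂(compoundPoisson lam) =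
      (compoundPoisson lam).real (Set.Iic y) := by
    unfold kolmogorovTest
    exact integral_indicator_one measurableSet_Iic
  have h2 : (compoundPoisson lam).real {0} ≤ (compoundPoisson lam).real (Set.Iic y) :=
    measureReal_mono (by simp)
  rw [hl.measureReal_zero] at h2
  rw [h1, abs_of_nonneg (sub_nonneg.2 measureReal_le_one)]
  linarith

/-- At `x = 0` the equation reads `∑ j λ_j f j = 1 - E h(U)`. Replace each `f j` by `f 1`, at a cost
of `j - 1` increments. -/
lemma IsSteinSolution.abs_apply_one_le {J : ℕ} {lam : ℕ → ℝ} (hl : IsClumpRate J lam) {y : ℕ}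
    {f : ℕ → ℝ} (hf : IsSteinSolution lam (kolmogorovTest y) f) {M : ℝ}
    (hM : ∀ x, 1 ≤ x → |f (x + 1) - f x| ≤ M) :
    (∑ j ∈ Finset.range J, (j : ℝ) * lam j) * |f 1| ≤
      1 - Real.exp (-totalRate lam) +
        (∑ j ∈ Finset.range J, (j : ℝ) * (j - 1) * lam j) * M := by
  have hdist : ∀ n : ℕ, |f (n + 1) - f 1| ≤ n * M := by
    intro n
    induction n with
    | zero => simp
    | succ n ih =>
      have h1 := hM (n + 1) (by omega)
      have h2 := abs_sub_le (f (n + 1 + 1)) (f (n + 1)) (f 1)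
      push_cast
      linarith
  have h0 := hf.equation 0
  have hk : kolmogorovTest y 0 = 1 := by simp [kolmogorovTest]
  rw [hl.tsum_eq (fun j => f (0 + j)), hk] at h0
  simp only [zero_add, Nat.cast_zero, zero_mul, sub_zero] at h0
  have hsplit : (∑ j ∈ Finset.range J, (j : ℝ) * lam j) * f 1 =
      (1 - ∫ u, kolmogorovTest y u ∂(compoundPoisson lam)) -
        ∑ j ∈ Finset.range J, (j : ℝ) * lam j * (f j - f 1) := by
    rw [h0, Finset.sum_mul, ← Finset.sum_sub_distrib]
    exact Finset.sum_congr rfl fun j _ => by ring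
  have hnn : ∀ j : ℕ, 0 ≤ (j : ℝ) * lam j := fun j => mul_nonneg (by positivity) (hl.nonneg j)
  have hsum : |∑ j ∈ Finset.range J, (j : ℝ) * lam j * (f j - f 1)| ≤
      (∑ j ∈ Finset.range J, (j : ℝ) * (j - 1) * lam j) * M := by
    rw [Finset.sum_mul]
    refine (Finset.abs_sum_le_sum_abs _ _).trans (Finset.sum_le_sum fun j _ => ?_)
    rcases Nat.eq_zero_or_pos j with rfl | hj
    · simp
    · obtain ⟨n, rfl⟩ := Nat.exists_eq_add_of_le' hj
      rw [abs_mul, abs_of_nonneg (hnn _)]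
      refine (mul_le_mul_of_nonneg_left (hdist n) (hnn _)).trans (le_of_eq ?_)
      push_cast
      ring
  have habs : |∑ j ∈ Finset.range J, (j : ℝ) * lam j| = ∑ j ∈ Finset.range J, (j : ℝ) * lam j :=
    abs_of_nonneg (Finset.sum_nonneg fun j _ => hnn j)
  rw [← habs, ← abs_mul, hsplit]
  exact (abs_sub _ _).trans (add_le_add (hl.abs_one_sub_integral_kolmogorovTest_le y) hsum)

/-- The tangent to `exp (-x)` at `x = log 2`, where its slope is `-1/2`. -/
lemma one_sub_exp_neg_le (x : ℝ) : 1 - Real.exp (-x) ≤ 0.154 + x / 2 := by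
  have h := Real.add_one_le_exp (-x + Real.log 2)
  rw [Real.exp_add, Real.exp_log two_pos] at h
  have := Real.log_two_gt_d9
  linarith

/-- The numerical inequality bounding the first value of the Stein solution. -/
lemma two_mul_add_le_one_add_posLog {δ β P m : ℝ} (hδ : 0 < δ) (hβ0 : 0 ≤ β) (hβ1 : β ≤ 1)
    (hm : 0 < m) (hδm : δ ≤ β * m) (hP0 : 0 ≤ P) (hP1 : P ≤ 1) (hP : P ≤ 0.154 + m / 2) :
    2 * (δ / m) * P + (1 - β) * (Real.posLog (Real.pi * δ) + 4 / Real.pi ^ 2) ≤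
      1 + Real.posLog (Real.pi * δ) := by
  set L := Real.posLog (Real.pi * δ) with hL
  have hL0 : 0 ≤ L := Real.posLog_nonneg
  have hpi := Real.pi_gt_d2
  have hκ : 4 / Real.pi ^ 2 ≤ 0.406 := by
    rw [div_le_iff₀ (by positivity)]; nlinarith
  set a := δ / m with ha
  have ha0 : 0 < a := div_pos hδ hm
  have haβ : a ≤ β := by rw [ha, div_le_iff₀ hm]; exact hδm
  have ham : a * m = δ := by rw [ha]; field_simp
  have hb1 : 2 * a * P ≤ 2 * β := by nlinarith
  have hb2 : 2 * a * P ≤ 0.308 * β + δ := by nlinarith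
  have hκ' : (1 - β) * (L + 4 / Real.pi ^ 2) ≤ (1 - β) * (L + 0.406) := by
    apply mul_le_mul_of_nonneg_left _ (by linarith); linarith
  -- This is precisely the condition under which `hb1` suffices. Otherwise `β` is bounded below and
  -- `L ≤ 1`, so `δ` is small enough for `hb2`.
  by_cases hc : β * (2 - L - 0.406) ≤ 1 - 0.406
  · nlinarith
  · push Not at hc
    have hβ : 0.372 ≤ β := by nlinarith
    have hL1 : L ≤ 1 := by nlinarith
    have hδL : Real.pi * δ ≤ 1 + L + L ^ 2 := by
      have h1 : Real.pi * δ ≤ Real.exp L := by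
        rw [hL]
        have hp : 0 < Real.pi * δ := by positivity
        refine le_trans (Real.exp_log hp).symm.le (Real.exp_le_exp.2 ?_)
        exact le_max_right _ _
      have h2 := Real.abs_exp_sub_one_sub_id_le (x := L) (by rwa [abs_of_nonneg hL0])
      have h3 := (abs_le.1 h2).2
      linarith
    have hδ' : δ ≤ 0.3185 + 0.637 * L := by nlinarith
    nlinarith

/-- A dissipative family of rates whose mean clump size is small enough has Stein factor of
order `log δ / δ`. -/
lemma IsDissipative.steinM1K_le {J : ℕ} {lam : ℕ → ℝ} {δ : ℝ} (hl : IsClumpRate J lam)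
    (hd : IsDissipative J lam δ) (hδ : 0 < δ)
    (hδm : δ ≤ ∑ j ∈ Finset.range J, (j : ℝ) * (2 - j) * lam j) :
    steinM1K lam ≤ ENNReal.ofReal ((2 * δ)⁻¹ * (1 + Real.posLog (Real.pi * δ))) := by
  unfold steinM1K
  refine iSup_le fun y => iSup_le fun f => iSup_le fun hf => iSup_le fun x => ?_
  apply ENNReal.ofReal_le_ofReal
  rw [le_inv_mul_iff₀ (by positivity)]
  have hsol := hd.isSteinSolution hl hδ y
  obtain rfl := hf.unique hl hsol
  set f := steinSolution J lam y with hfdef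
  have hL0 : 0 ≤ Real.posLog (Real.pi * δ) := Real.posLog_nonneg
  have hκ : 4 / Real.pi ^ 2 ≤ 1 := by
    rw [div_le_one (by positivity)]; nlinarith [Real.pi_gt_three]
  have hinc : ∀ x, 1 ≤ x → 2 * δ * |f (x + 1) - f x| ≤
      Real.posLog (Real.pi * δ) + 4 / Real.pi ^ 2 := fun x hx =>
    hd.abs_steinSolution_succ_sub_le hδ y hx
  rcases Nat.eq_zero_or_pos x with rfl | hx
  · rw [hsol.zero, sub_zero, zero_add]
    set M := (Real.posLog (Real.pi * δ) + 4 / Real.pi ^ 2) / (2 * δ) with hM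
    have h1 := hsol.abs_apply_one_le hl (M := M) fun x hx => by
      rw [hM, le_div_iff₀ (by positivity), mul_comm]; exact hinc x hx
    set m := ∑ j ∈ Finset.range J, (j : ℝ) * lam j with hm
    set D := ∑ j ∈ Finset.range J, (j : ℝ) * (j - 1) * lam j with hD
    have hmD : ∑ j ∈ Finset.range J, (j : ℝ) * (2 - j) * lam j = m - D := by
      rw [hm, hD, ← Finset.sum_sub_distrib]
      exact Finset.sum_congr rfl fun j _ => by ring
    have hD0 : 0 ≤ D := Finset.sum_nonneg fun j _ => by
      rcases Nat.eq_zero_or_pos j with rfl | hj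
      · simp
      · have : (1 : ℝ) ≤ j := by exact_mod_cast hj
        have := hl.nonneg j
        exact mul_nonneg (mul_nonneg (by positivity) (by linarith)) this
    have hm0 : 0 < m := by linarith
    have htm : totalRate lam ≤ m := by
      rw [hl.totalRate_eq, hm]
      refine Finset.sum_le_sum fun j _ => ?_
      rcases Nat.eq_zero_or_pos j with rfl | hj
      · simp [hl.zero]
      · have : (1 : ℝ) ≤ j := by exact_mod_cast hj
        nlinarith [hl.nonneg j]
    have hP0 : 0 ≤ 1 - Real.exp (-totalRate lam) := by
      rw [sub_nonneg, Real.exp_le_one_iff]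
      linarith [hl.totalRate_pos]
    -- With `β = 1 - D / m`, the hypothesis on `∑ j (2 - j) λ_j = m - D` becomes `δ ≤ β m`.
    have h2 := two_mul_add_le_one_add_posLog (β := 1 - D / m)
      (P := 1 - Real.exp (-totalRate lam)) hδ
      (by rw [sub_nonneg, div_le_one hm0]; linarith)
      (by have := div_nonneg hD0 hm0.le; linarith) hm0
      (by rw [sub_mul, div_mul_cancel₀ _ hm0.ne']; linarith) hP0
      (by linarith [Real.exp_pos (-totalRate lam)])
      (by linarith [one_sub_exp_neg_le (totalRate lam)])
    refine le_trans ?_ h2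
    have h3 : 2 * (δ / m) * (1 - Real.exp (-totalRate lam)) +
        (1 - (1 - D / m)) * (Real.posLog (Real.pi * δ) + 4 / Real.pi ^ 2) =
        2 * δ * ((1 - Real.exp (-totalRate lam) + D * M) / m) := by
      have : Real.posLog (Real.pi * δ) + 4 / Real.pi ^ 2 = 2 * δ * M := by
        rw [hM]; field_simp
      rw [this]
      field_simp
      ring
    rw [h3]
    gcongr
    rw [le_div_iff₀ hm0, mul_comm]
    exact h1
  · have := hinc x hx
    linarith

/-! ### Dissipation of powers of an affine factor. -/

/-- On the circle `(z - 1) ^ 2 = z (z + z⁻¹ - 2)`. Hence every power of `ζ = z - 1` is a real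
combination of `1` and `ζ`. -/
lemma sub_one_sq_of_norm_one (θ : ℝ) : (Complex.exp (θ * I) - 1) ^ 2 =
    ((-2 * (1 - Real.cos θ) : ℝ) : ℂ) * (1 + (Complex.exp (θ * I) - 1)) := by
  have h : (Complex.sin θ) ^ 2 = 1 - (Complex.cos θ) ^ 2 := by
    rw [← Complex.sin_sq_add_cos_sq (θ : ℂ)]; ring
  rw [Complex.exp_mul_I]
  push_cast
  linear_combination (Complex.sin θ) ^ 2 * Complex.I_sq - h

section DissipationOfPowers
variable {ζ : ℂ} {v : ℝ} (hre : ζ.re = -v) (hsq : ζ ^ 2 = ((-2 * v : ℝ) : ℂ) * (1 + ζ))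
  (hv0 : 0 ≤ v) (hv2 : v ≤ 2) {r : ℝ} (hr0 : 0 ≤ r) (hr : r ≤ 1 / 4)
include hre hsq hv0 hv2 hr0 hr

/-- Equality holds at `v = 0` and `v = 2`, i.e. `z = ±1`, so the gap factors through `v * r * (2 -
v)` and only the cofactor's sign matters. The cubic and quartic cases follow the same pattern. -/
lemma re_mul_one_add_pow_two_le :
    (ζ * (1 + r * ζ) ^ 2).re ≤ -(v * (1 - 2 * r) ^ 2) := by
  have h : ζ * (1 + r * ζ) ^ 2 =
      ((-4 * r * v + 4 * r ^ 2 * v ^ 2 : ℝ) : ℂ) +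
        ((1 - 4 * r * v + r ^ 2 * (4 * v ^ 2 - 2 * v) : ℝ) : ℂ) * ζ := by
    push_cast at hsq ⊢
    linear_combination (2 * r + r ^ 2 * (ζ - 2 * v)) * hsq
  rw [h, Complex.add_re, Complex.ofReal_re, Complex.re_ofReal_mul, hre]
  have h1 : 0 ≤ v * r * (2 - v) * (4 - r * (4 * v + 2)) := by
    have : 0 ≤ 4 - r * (4 * v + 2) := by nlinarith
    have := sub_nonneg.2 hv2
    positivity
  nlinarith

lemma re_mul_one_add_pow_three_le :
    (ζ * (1 + r * ζ) ^ 3).re ≤ -(v * (1 - 2 * r) ^ 3) := by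
  have h3 : ζ ^ 3 = ((4 * v ^ 2 : ℝ) : ℂ) + ((4 * v ^ 2 - 2 * v : ℝ) : ℂ) * ζ := by
    push_cast at hsq ⊢
    linear_combination (ζ - 2 * v) * hsq
  have h4 : ζ ^ 4 = ((4 * v ^ 2 - 8 * v ^ 3 : ℝ) : ℂ) + ((8 * v ^ 2 - 8 * v ^ 3 : ℝ) : ℂ) * ζ := by
    push_cast at hsq h3 ⊢
    linear_combination ζ * h3 + (4 * v ^ 2 - 2 * v) * hsq
  have h : ζ * (1 + r * ζ) ^ 3 =
      ζ + ((3 * r : ℝ) : ℂ) * ζ ^ 2 + ((3 * r ^ 2 : ℝ) : ℂ) * ζ ^ 3 +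
        ((r ^ 3 : ℝ) : ℂ) * ζ ^ 4 := by
    push_cast; ring
  rw [h, h4, h3, hsq]
  simp only [Complex.add_re, Complex.re_ofReal_mul, Complex.ofReal_re, hre, Complex.one_re]
  have h1 : 0 ≤ v * r * (2 - v) * (6 - 6 * r * (2 * v + 1) + 4 * r ^ 2 * (2 * v ^ 2 + 1)) := by
    have h5 : 0 ≤ 1 / 2 - r * v := by nlinarith
    have h6 : 0 ≤ 1 / 4 - r := by linarith
    -- Positivity certificate in the nonnegative quantities `1/2 - r v` and `1/4 - r`.
    have h7 : 6 - 6 * r * (2 * v + 1) + 4 * r ^ 2 * (2 * v ^ 2 + 1) =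
        3 / 4 + 4 * (1 / 2 - r * v) + 8 * (1 / 2 - r * v) ^ 2 + 4 * (1 / 4 - r) +
          4 * (1 / 4 - r) ^ 2 := by ring
    have : 0 ≤ 6 - 6 * r * (2 * v + 1) + 4 * r ^ 2 * (2 * v ^ 2 + 1) := by
      rw [h7]; positivity
    have := sub_nonneg.2 hv2
    positivity
  linarith

lemma re_mul_one_add_pow_four_le :
    (ζ * (1 + r * ζ) ^ 4).re ≤ -(v * (1 - 2 * r) ^ 4) := by
  have h3 : ζ ^ 3 = ((4 * v ^ 2 : ℝ) : ℂ) + ((4 * v ^ 2 - 2 * v : ℝ) : ℂ) * ζ := by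
    push_cast at hsq ⊢
    linear_combination (ζ - 2 * v) * hsq
  have h4 : ζ ^ 4 = ((4 * v ^ 2 - 8 * v ^ 3 : ℝ) : ℂ) + ((8 * v ^ 2 - 8 * v ^ 3 : ℝ) : ℂ) * ζ := by
    push_cast at hsq h3 ⊢
    linear_combination ζ * h3 + (4 * v ^ 2 - 2 * v) * hsq
  have h5 : ζ ^ 5 = ((16 * v ^ 4 - 16 * v ^ 3 : ℝ) : ℂ) +
      ((4 * v ^ 2 - 24 * v ^ 3 + 16 * v ^ 4 : ℝ) : ℂ) * ζ := by
    push_cast at hsq h4 ⊢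
    linear_combination ζ * h4 + (8 * v ^ 2 - 8 * v ^ 3) * hsq
  have h : ζ * (1 + r * ζ) ^ 4 =
      ζ + ((4 * r : ℝ) : ℂ) * ζ ^ 2 + ((6 * r ^ 2 : ℝ) : ℂ) * ζ ^ 3 +
        ((4 * r ^ 3 : ℝ) : ℂ) * ζ ^ 4 + ((r ^ 4 : ℝ) : ℂ) * ζ ^ 5 := by
    push_cast; ring
  rw [h, h5, h4, h3, hsq]
  simp only [Complex.add_re, Complex.re_ofReal_mul, Complex.ofReal_re, hre, Complex.one_re]
  set B := 8 - 12 * r * (2 * v + 1) + 16 * r ^ 2 * (2 * v ^ 2 + 1) -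
    4 * r ^ 3 * (4 * v ^ 3 - 2 * v ^ 2 + v + 2) with hB
  have h1 : 0 ≤ v * r * (2 - v) * B := by
    have hu : 0 ≤ 1 / 2 - r * v := by nlinarith
    have hs : 0 ≤ 1 / 4 - r := by linarith
    have h7 : B = 1 / 4 + 9 / 4 * (1 / 2 - r * v) + 9 / 2 * (1 / 4 - r) +
        8 * (1 / 2 - r * v) ^ 2 + 8 * r * (1 / 2 - r * v) ^ 2 + 8 * (1 / 4 - r) ^ 2 +
        6 * (1 / 4 - r) * (1 / 2 - r * v) + 16 * (1 / 2 - r * v) ^ 3 + 8 * (1 / 4 - r) ^ 3 +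
        4 * (1 / 4 - r) ^ 2 * (1 / 2 - r * v) := by rw [hB]; ring
    have : 0 ≤ B := by rw [h7]; positivity
    have := sub_nonneg.2 hv2
    positivity
  rw [hB] at h1
  linarith

end DissipationOfPowers

/-! ### The reliability rates. -/

/-- The closed form of `j * λ_j` for the reliability rates. -/
lemma mul_reliabilityRate (n k : ℕ) (q : unitInterval) (j : ℕ) (hj : j < 5) :
    ((j + 1 : ℕ) : ℝ) * reliabilityRate n k q (j + 1) =
      (q : ℝ) ^ k ^ 2 *
        (4 * ((Nat.choose 2 j) * ((q : ℝ) ^ k) ^ j * (1 - (q : ℝ) ^ k) ^ (2 - j)) +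
          4 * ((n : ℝ) - k - 1) *
            ((Nat.choose 3 j) * ((q : ℝ) ^ k) ^ j * (1 - (q : ℝ) ^ k) ^ (3 - j)) +
          ((n : ℝ) - k - 1) ^ 2 *
            ((Nat.choose 4 j) * ((q : ℝ) ^ k) ^ j * (1 - (q : ℝ) ^ k) ^ (4 - j))) := by
  have h : ((j + 1 : ℕ) : ℝ) ≠ 0 := by positivity
  -- The subtractions `2 - j` and `3 - j` truncate only where the binomial coefficient vanishes.
  rw [reliabilityRate, if_pos (by omega)]
  simp only [reliabilityPi, binomial_real_singleton, Nat.add_sub_cancel]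
  norm_num
  field_simp

lemma reliabilityRate_nonneg {n k : ℕ} (hkn : k + 1 ≤ n) (q : unitInterval) (j : ℕ) :
    0 ≤ reliabilityRate n k q j := by
  have hN : (0 : ℝ) ≤ (n : ℝ) - k - 1 := by
    have : ((k + 1 : ℕ) : ℝ) ≤ n := by exact_mod_cast hkn
    push_cast at this
    linarith
  have hq := q.2.1
  unfold reliabilityRate reliabilityPi
  split_ifs
  · positivity
  · exact le_rfl

lemma isClumpRate_reliabilityRate {n k : ℕ} (hkn : k + 1 ≤ n) {q : unitInterval}
    (hq0 : 0 < (q : ℝ)) (hq : (q : ℝ) ^ k < 1 / 4) : IsClumpRate 6 (reliabilityRate n k q) where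
  nonneg := reliabilityRate_nonneg hkn q
  zero := by simp [reliabilityRate]
  support j hj := by
    rw [reliabilityRate, if_neg (by omega)]
  pos := by
    refine Finset.sum_pos' (fun j _ => reliabilityRate_nonneg hkn q j) ⟨1, by simp, ?_⟩
    have hN : (0 : ℝ) ≤ (n : ℝ) - k - 1 := by
      have : ((k + 1 : ℕ) : ℝ) ≤ n := by exact_mod_cast hkn
      push_cast at this
      linarith
    have h1 := mul_reliabilityRate n k q 0 (by norm_num)
    have hp : 0 < 1 - (q : ℝ) ^ k := by linarith
    simp only [zero_add, Nat.cast_one, one_mul, Nat.choose_zero_right] at h1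
    rw [h1]
    positivity

/-- The factor `j` cancels the `1 / j` in the rates, leaving binomial generating functions. -/
lemma logPgfDeriv_reliabilityRate (n k : ℕ) (q : unitInterval) (ζ : ℂ) :
    logPgfDeriv 6 (reliabilityRate n k q) (1 + ζ) =
      ((q : ℝ) ^ k ^ 2 : ℝ) * (4 * (1 + ((q : ℝ) ^ k : ℝ) * ζ) ^ 2 +
        ((4 * ((n : ℝ) - k - 1) : ℝ) : ℂ) * (1 + ((q : ℝ) ^ k : ℝ) * ζ) ^ 3 +
        ((((n : ℝ) - k - 1) ^ 2 : ℝ) : ℂ) * (1 + ((q : ℝ) ^ k : ℝ) * ζ) ^ 4) := by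
  unfold logPgfDeriv
  rw [Finset.sum_range_succ']
  simp only [Nat.cast_zero, zero_mul, Complex.ofReal_zero, add_zero, Nat.add_sub_cancel]
  rw [Finset.sum_congr rfl fun j hj => by
    rw [mul_reliabilityRate n k q j (Finset.mem_range.1 hj)]]
  simp only [Finset.sum_range_succ, Finset.sum_range_zero, Nat.choose]
  push_cast
  ring

/-- The sum is `L'(1) - L''(1)`. -/
lemma sum_mul_two_sub_reliabilityRate (n k : ℕ) (q : unitInterval) :
    ∑ j ∈ Finset.range 6, (j : ℝ) * (2 - j) * reliabilityRate n k q j =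
      (q : ℝ) ^ k ^ 2 * (4 * (1 - 2 * (q : ℝ) ^ k) +
        4 * ((n : ℝ) - k - 1) * (1 - 3 * (q : ℝ) ^ k) +
        ((n : ℝ) - k - 1) ^ 2 * (1 - 4 * (q : ℝ) ^ k)) := by
  simp only [mul_right_comm (Nat.cast _ : ℝ)]
  rw [Finset.sum_range_succ']
  rw [Finset.sum_congr rfl fun j hj => by
    rw [mul_reliabilityRate n k q j (Finset.mem_range.1 hj)]]
  simp only [Finset.sum_range_succ, Finset.sum_range_zero, Nat.choose]
  push_cast
  ring

section
variable {n k : ℕ} (hkn : k + 1 ≤ n) {q : unitInterval} (hq0 : 0 < (q : ℝ))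
  (hq : (q : ℝ) ^ k < 1 / 4)
include hkn hq0 hq

lemma reliabilityDelta_pos : 0 < reliabilityDelta n k q := by
  have hN : (0 : ℝ) ≤ (n : ℝ) - k - 1 := by
    have : ((k + 1 : ℕ) : ℝ) ≤ n := by exact_mod_cast hkn
    push_cast at this
    linarith
  have hp : 0 < (q : ℝ) ^ k := by positivity
  have h1 : 0 < 1 - 2 * (q : ℝ) ^ k := by linarith
  have h2 : 0 < 1 - 4 * (q : ℝ) ^ k := by linarith
  unfold reliabilityDelta
  have h3 : 0 < 1 - 4 * (q : ℝ) ^ k + 8 * (q : ℝ) ^ (2 * k) := by positivity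
  positivity

/-- This comparison is why the last term of `δ` is not `(1 - 2 p) ^ 4`: as `p → 1/4` that stays
positive while `1 - 4 p` tends to `0`. -/
lemma reliabilityDelta_le_sum : reliabilityDelta n k q ≤
    ∑ j ∈ Finset.range 6, (j : ℝ) * (2 - j) * reliabilityRate n k q j := by
  have hN : (0 : ℝ) ≤ (n : ℝ) - k - 1 := by
    have : ((k + 1 : ℕ) : ℝ) ≤ n := by exact_mod_cast hkn
    push_cast at this
    linarith
  rw [sum_mul_two_sub_reliabilityRate, reliabilityDelta, pow_mul' (q : ℝ) 2 k]
  set p := (q : ℝ) ^ k with hp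
  have hp0 : 0 < p := by positivity
  have h4 : 0 < 1 - 4 * p := by linarith
  have hpp : 4 * p ^ 2 ≤ p := by nlinarith
  gcongr ?_ * (4 * ?_ + _ * ?_ + _ * ?_)
  · nlinarith
  · nlinarith
  · nlinarith

lemma isDissipative_reliabilityRate :
    IsDissipative 6 (reliabilityRate n k q) (reliabilityDelta n k q) := by
  intro r hr θ
  have hN : (0 : ℝ) ≤ (n : ℝ) - k - 1 := by
    have : ((k + 1 : ℕ) : ℝ) ≤ n := by exact_mod_cast hkn
    push_cast at this
    linarith
  rw [logPgfDeriv_reliabilityRate, reliabilityDelta, pow_mul' (q : ℝ) 2 k]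
  have hψ : 0 < (q : ℝ) ^ k ^ 2 := by positivity
  set ψ := (q : ℝ) ^ k ^ 2
  set N := (n : ℝ) - k - 1
  set p := (q : ℝ) ^ k with hp
  set ζ := Complex.exp (θ * I) - 1 with hζ
  set v := 1 - Real.cos θ with hv
  have hp0 : 0 < p := by positivity
  have hre : ζ.re = -v := by
    rw [hζ, Complex.sub_re, Complex.exp_ofReal_mul_I_re, hv]; simp
  have hsq : ζ ^ 2 = ((-2 * v : ℝ) : ℂ) * (1 + ζ) := sub_one_sq_of_norm_one θ
  have hv0 : 0 ≤ v := sub_nonneg.2 (Real.cos_le_one θ)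
  have hv2 : v ≤ 2 := by linarith [Real.neg_one_le_cos θ]
  have hρ0 : 0 ≤ p * r := mul_nonneg hp0.le hr.1
  have hρp : p * r ≤ p := mul_le_of_le_one_right hp0.le hr.2
  have hρ : p * r ≤ 1 / 4 := by linarith
  have h2 := re_mul_one_add_pow_two_le hre hsq hv0 hv2 hρ0 hρ
  have h3 := re_mul_one_add_pow_three_le hre hsq hv0 hv2 hρ0 hρ
  have h4 := re_mul_one_add_pow_four_le hre hsq hv0 hv2 hρ0 hρ
  have e : ζ * ((ψ : ℂ) * (4 * (1 + (p : ℂ) * (r * ζ)) ^ 2 +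
      ((4 * N : ℝ) : ℂ) * (1 + (p : ℂ) * (r * ζ)) ^ 3 +
      ((N ^ 2 : ℝ) : ℂ) * (1 + (p : ℂ) * (r * ζ)) ^ 4)) =
      (ψ : ℂ) * (((4 : ℝ) : ℂ) * (ζ * (1 + (p * r : ℝ) * ζ) ^ 2) +
      ((4 * N : ℝ) : ℂ) * (ζ * (1 + (p * r : ℝ) * ζ) ^ 3) +
      ((N ^ 2 : ℝ) : ℂ) * (ζ * (1 + (p * r : ℝ) * ζ) ^ 4)) := by
    push_cast; ring
  rw [e, Complex.re_ofReal_mul, Complex.add_re, Complex.add_re, Complex.re_ofReal_mul,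
    Complex.re_ofReal_mul, Complex.re_ofReal_mul]
  have hmono : ∀ m : ℕ, v * (1 - 2 * p) ^ m ≤ v * (1 - 2 * (p * r)) ^ m := fun m => by
    have : 0 ≤ 1 - 2 * p := by linarith
    gcongr
  have h2' := h2.trans (neg_le_neg (hmono 2))
  have h3' := h3.trans (neg_le_neg (hmono 3))
  -- The polynomial on the left is `(1 - 2 p) ^ 4 - 16 p ^ 4`.
  have hc : v * ((1 - 4 * p) * (1 - 4 * p + 8 * p ^ 2)) ≤ v * (1 - 2 * p) ^ 4 := by
    gcongr
    nlinarith [pow_pos hp0 4]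
  have h4' := h4.trans (neg_le_neg (hc.trans (hmono 4)))
  calc _ ≤ ψ * (4 * -(v * (1 - 2 * p) ^ 2) + 4 * N * -(v * (1 - 2 * p) ^ 3) +
        N ^ 2 * -(v * ((1 - 4 * p) * (1 - 4 * p + 8 * p ^ 2)))) := by gcongr
    _ = _ := by ring

end

end

theorem mainTheorem4 (n k : ℕ) (hkn : k + 1 ≤ n) (q : unitInterval) (hq0 : 0 < (q : ℝ))
    (hq : (q : ℝ) ^ k < 1 / 4) :
    (∀ y : ℕ, ∃! f : ℕ → ℝ,
      IsSteinSolution (reliabilityRate n k q) (kolmogorovTest y) f) ∧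
    0 < reliabilityDelta n k q ∧
    steinM1K (reliabilityRate n k q) ≤
      ENNReal.ofReal ((2 * reliabilityDelta n k q)⁻¹ *
        (1 + Real.posLog (Real.pi * reliabilityDelta n k q))) := by
  have hl := isClumpRate_reliabilityRate hkn hq0 hq
  have hd := isDissipative_reliabilityRate hkn hq0 hq
  have hδ := reliabilityDelta_pos hkn hq0 hq
  refine ⟨fun y => ?_, hδ, hd.steinM1K_le hl hδ (reliabilityDelta_le_sum hkn hq0 hq)⟩
  exact ⟨_, hd.isSteinSolution hl hδ y, fun g hg => hg.unique hl (hd.isSteinSolution hl hδ y)⟩
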